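/- Let $t \ge 2$ and $n$ be integers, and let $\mathcal{L} = \{l_1, l_2, \dots, l_s\}$ be a set of $s \ge 1$ nonnegative integers with $0 \le l_1 < l_2 < \cdots < l_s$ and $s < n$. Suppose that $\mathcal{A} = \{A_1, A_2, \dots, A_m\}$ is a family of $m$ distinct subsets of $[n] = \{1, \dots, n\}$ such that $|A_{i_1} \cap A_{i_2} \cap \cdots \cap A_{i_t}| \in \mathcal{L}$ for every collection of $t$ distinct members of $\mathcal{A}$, and $|A_i| \notin \mathcal{L}$ for every $1 \le i \le m$. If $$n \ge \binom{k^2}{l_1+1}\, s + l_1, \qquad \text{where } k = \max_{1 \le j \le m} |A_j|$$ (with $k = 0$ if $\mathcal{A}$ is empty), then $$|\mathcal{A}| \le (t-1)\binom{n}{s}.$$ -/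

import Mathlib

/-- A family `A` of subsets of `[n]` (modelled by `Fin n`) is `t`-wise `L`-intersecting if
`|A₁ ∩ ⋯ ∩ A_t| ∈ L` for every collection `{A₁, …, A_t}` of `t` distinct members of `A`. -/
def IsTWiseIntersecting {n : ℕ} (t : ℕ) (L : Finset ℕ) (A : Finset (Finset (Fin n))) : Prop :=
  ∀ B : Finset (Finset (Fin n)), B ⊆ A → B.card = t → (B.inf id).card ∈ L

/-- The largest size of a member of the family `A` (and `0` if `A` is empty). -/
def maxMemberSize {n : ℕ} (A : Finset (Finset (Fin n))) : ℕ :=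
  A.sup Finset.card

/-! Write l = min L, s = |L|. Linear algebra in the span of the indicators [I ⊆ S], |I| ≤ s, gives
|A| ≤ (t-1) ∑_{i ≤ s} C(n,i). If some element of L is never a `t`-wise intersection size, the sum
stops at i < s, a gain of order n/s. This gain is forced as follows. A sunflower argument yields
either a kernel T of size l contained in all members, or a set U of at most k² - k + 1 points
meeting every member in more than l points. With U, sort the members by an (l+1)-subset of U they
contain: each class avoids the size l, and the hypothesis on n absorbs the number C(|U|, l+1) of
classes. With T, if L is an interval, count the s-subsets of F \ T. Otherwise m = max L is at least
l + s: members of size at most m avoid the intersection size m, and larger ones are double counted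
by their points outside T, the members through such a point avoiding the size l. -/

/-! ### The linear algebra bound -/

open Finset in
theorem prod_card_inter_sub_mem_span {α : Type*} [Fintype α] [DecidableEq α]
    (L : Finset ℕ) (B : Finset α) :
    (fun S : Finset α => ∏ l ∈ L, (((S ∩ B).card : ℚ) - l)) ∈
      Submodule.span ℚ ((fun (I S : Finset α) => if I ⊆ S then (1 : ℚ) else 0) ''
        {I | I.card ≤ L.card}) := by
  induction L using Finset.induction_on with
  | empty =>
    refine Submodule.subset_span ⟨∅, by simp, ?_⟩
    ext S; simp
  | insert a L ha ih =>
    rw [card_insert_of_notMem ha]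
    simp only [prod_insert ha]
    suffices h : ∀ f ∈ Submodule.span ℚ ((fun (I S : Finset α) => if I ⊆ S then (1 : ℚ) else 0) ''
        {I | I.card ≤ L.card}), (fun S : Finset α => (((S ∩ B).card : ℚ) - a) * f S) ∈
          Submodule.span ℚ ((fun (I S : Finset α) => if I ⊆ S then (1 : ℚ) else 0) ''
            {I | I.card ≤ L.card + 1}) from h _ ih
    intro f hf
    induction hf using Submodule.span_induction with
    | mem f hf =>
      obtain ⟨I, hI, rfl⟩ := hf
      have hI : I.card ≤ L.card := hI
      -- Since |S ∩ B| = ∑_{x ∈ B} [x ∈ S] and [x ∈ S][I ⊆ S] = [I ∪ {x} ⊆ S], each factor raises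
      -- the degree by at most one.
      have : (fun S : Finset α => (((S ∩ B).card : ℚ) - a) * (if I ⊆ S then (1 : ℚ) else 0)) =
          (∑ x ∈ B, fun S : Finset α => if insert x I ⊆ S then (1 : ℚ) else 0) -
            (a : ℚ) • fun S : Finset α => if I ⊆ S then (1 : ℚ) else 0 := by
        ext S
        simp only [Pi.sub_apply, Finset.sum_apply, Pi.smul_apply, smul_eq_mul, sub_mul]
        congr 1
        by_cases h : I ⊆ S
        · simp [h, insert_subset_iff, inter_comm]
        · simp [h, insert_subset_iff]
      rw [this]
      refine Submodule.sub_mem _ (Submodule.sum_mem _ fun x _ => ?_)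
        (Submodule.smul_mem _ _ (Submodule.subset_span ⟨I, ?_, rfl⟩))
      · exact Submodule.subset_span ⟨insert x I, (card_insert_le x I).trans (by omega), rfl⟩
      · change I.card ≤ L.card + 1
        omega
    | zero => simp only [Pi.zero_apply, mul_zero]; exact Submodule.zero_mem _
    | add f g _ _ hf hg =>
      simp only [Pi.add_apply, mul_add]
      exact Submodule.add_mem _ hf hg
    | smul c f _ hf =>
      simp only [Pi.smul_apply, smul_eq_mul, mul_left_comm _ c]
      exact Submodule.smul_mem _ c hf

/-- The space of rational functions vanishing on `A`. -/
def vanishingOn {X : Type*} (A : Finset X) : Submodule ℚ (X → ℚ) where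
  carrier := {f | ∀ a ∈ A, f a = 0}
  add_mem' := by intro f g hf hg a ha; simp [hf a ha, hg a ha]
  zero_mem' := by intro a _; rfl
  smul_mem' := by intro c f hf a ha; simp [hf a ha]

theorem IsTWiseIntersecting.mono {n t : ℕ} {L : Finset ℕ} {A A' : Finset (Finset (Fin n))}
    (hA : IsTWiseIntersecting t L A) (h : A' ⊆ A) : IsTWiseIntersecting t L A' :=
  fun B hB => hA B (hB.trans h)

-- Take B of maximal size among subfamilies with at most t - 1 members and intersection size outside
-- L. Adding D either produces t members, or would contradict maximality.
open Finset in
theorem IsTWiseIntersecting.exists_subfamily {n t : ℕ} (ht : 2 ≤ t) {L : Finset ℕ}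
    {A : Finset (Finset (Fin n))} (hA : IsTWiseIntersecting t L A)
    (hAL : ∀ F ∈ A, F.card ∉ L) (hne : A.Nonempty) :
    ∃ B ⊆ A, B.Nonempty ∧ B.card ≤ t - 1 ∧ (B.inf id).card ∉ L ∧
      ∀ D ∈ A \ B, (D ∩ B.inf id).card ∈ L := by
  let 𝒮 := A.powerset.filter fun B => B.Nonempty ∧ B.card ≤ t - 1 ∧ (B.inf id).card ∉ L
  have h𝒮 : 𝒮.Nonempty := by
    obtain ⟨F, hF⟩ := hne
    refine ⟨{F}, ?_⟩
    simp only [𝒮, mem_filter, mem_powerset, singleton_subset_iff, card_singleton, inf_singleton, id]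
    exact ⟨hF, singleton_nonempty F, by omega, hAL F hF⟩
  obtain ⟨B, hB, hmax⟩ := exists_max_image 𝒮 card h𝒮
  simp only [𝒮, mem_filter, mem_powerset] at hB hmax
  obtain ⟨hBA, hBne, hBt, hBL⟩ := hB
  refine ⟨B, hBA, hBne, hBt, hBL, fun D hD => ?_⟩
  obtain ⟨hDA, hDB⟩ := mem_sdiff.1 hD
  have hsub : insert D B ⊆ A := insert_subset hDA hBA
  have hcard := card_insert_of_notMem hDB
  have hinf : (insert D B).inf id = D ∩ B.inf id := by simp [inf_insert]
  rw [← hinf]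
  by_cases h : B.card = t - 1
  · exact hA _ hsub (by omega)
  · by_contra hL
    have := hmax _ ⟨hsub, insert_nonempty _ _, by omega, hL⟩
    omega

-- Peel off such a B: the polynomial of ⋂ B vanishes on A \ B but at no member of B. So each batch
-- of at most t - 1 members costs a dimension.
open Finset in
theorem IsTWiseIntersecting.card_add_finrank_le {n t : ℕ} (ht : 2 ≤ t) {L : Finset ℕ}
    {V : Submodule ℚ (Finset (Fin n) → ℚ)}
    (hV : ∀ B : Finset (Fin n), (fun S => ∏ l ∈ L, (((S ∩ B).card : ℚ) - l)) ∈ V)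
    (A : Finset (Finset (Fin n))) (hA : IsTWiseIntersecting t L A)
    (hAL : ∀ F ∈ A, F.card ∉ L) :
    A.card + (t - 1) * Module.finrank ℚ ↥(V ⊓ vanishingOn A) ≤ (t - 1) * Module.finrank ℚ V := by
  induction A using Finset.strongInduction with
  | H A ih =>
    rcases A.eq_empty_or_nonempty with rfl | hne
    · rw [card_empty, zero_add]
      exact Nat.mul_le_mul_left _ (Submodule.finrank_mono inf_le_left)
    obtain ⟨B, hBA, hBne, hBt, hBL, hB⟩ := hA.exists_subfamily ht hAL hne
    have h1 := ih (A \ B) (sdiff_ssubset hBA hBne) (hA.mono sdiff_subset)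
      fun F hF => hAL F (sdiff_subset hF)
    have hlt : V ⊓ vanishingOn A < V ⊓ vanishingOn (A \ B) := by
      refine lt_of_le_of_ne
        (inf_le_inf_left _ fun f hf a ha => hf a (sdiff_subset ha)) fun heq => ?_
      obtain ⟨D, hD⟩ := hBne
      have hmem : (fun S : Finset (Fin n) => ∏ l ∈ L, (((S ∩ B.inf id).card : ℚ) - l)) ∈
          V ⊓ vanishingOn (A \ B) :=
        ⟨hV _, fun F hF => prod_eq_zero (hB F hF) (sub_self _)⟩
      rw [← heq] at hmem
      have h0 := hmem.2 D (hBA hD)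
      obtain ⟨l, hl, h⟩ := prod_eq_zero_iff.1 h0
      have hDi : D ∩ B.inf id = B.inf id := inter_eq_right.2 (inf_le (f := id) hD)
      rw [hDi, sub_eq_zero, Nat.cast_inj] at h
      exact hBL (h ▸ hl)
    have h2 := Nat.mul_le_mul_left (t - 1) (Nat.succ_le_of_lt (Submodule.finrank_lt_finrank_of_lt hlt))
    have h3 := card_sdiff_add_card_eq_card hBA
    rw [Nat.mul_succ] at h2
    omega

open Finset in
/-- A `t`-wise `L`-intersecting family with no member of size in `L` has at most
`(t - 1) ∑_{i ≤ |L|} (n choose i)` members. -/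
theorem IsTWiseIntersecting.card_le {n t : ℕ} (ht : 2 ≤ t) {L : Finset ℕ}
    {A : Finset (Finset (Fin n))} (hA : IsTWiseIntersecting t L A)
    (hAL : ∀ F ∈ A, F.card ∉ L) :
    A.card ≤ (t - 1) * ∑ i ∈ range (L.card + 1), n.choose i := by
  have h := hA.card_add_finrank_le ht (fun B => prod_card_inter_sub_mem_span L B) A hAL
  refine (Nat.le_of_add_right_le h).trans (Nat.mul_le_mul_left _ ?_)
  have hset : {I : Finset (Fin n) | I.card ≤ L.card} =
      ↑((range (L.card + 1)).biUnion fun i => powersetCard i (univ : Finset (Fin n))) := by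
    ext I; simp [mem_powersetCard]
  rw [hset, ← coe_image]
  refine (finrank_span_finset_le_card _).trans (card_image_le.trans (card_biUnion_le.trans ?_))
  simp

/-! ### Elementary binomial estimates -/

/-- The ratio C(n,i+1)/C(n,i) = (n-i)/(i+1) is at least M + 1 for i < s, so the sum is dominated
geometrically. -/
theorem mul_sum_choose_le_choose (M n s : ℕ) (h : (M + 1) * s + s ≤ n + 1) :
    M * ∑ i ∈ Finset.range s, n.choose i ≤ n.choose s := by
  induction s with
  | zero => simp
  | succ s ih =>
    have h1 := ih (by nlinarith)
    rw [Finset.sum_range_succ, mul_add]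
    have h2 := Nat.choose_succ_right_eq n s
    have h3 : (M + 1) * (s + 1) ≤ n - s := by omega
    have h4 := Nat.mul_le_mul_left (n.choose s) h3
    have h5 : (M + 1) * n.choose s ≤ n.choose (s + 1) := by
      refine Nat.le_of_mul_le_mul_right (c := s + 1) ?_ (Nat.succ_pos s)
      nlinarith
    nlinarith

theorem Nat.le_choose_of_pos_of_lt {n r : ℕ} (hr : 0 < r) (hrn : r < n) : n ≤ n.choose r := by
  induction n generalizing r with
  | zero => omega
  | succ n ih =>
    obtain ⟨r, rfl⟩ : ∃ q, r = q + 1 := ⟨r - 1, by omega⟩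
    rw [Nat.choose_succ_succ']
    rcases Nat.lt_or_ge (r + 1) n with h | h
    · have := ih hr h
      have := Nat.choose_pos (n := n) (k := r) (by omega)
      omega
    · obtain rfl : n = r + 1 := by omega
      simp

/-! ### Kernel or small cover -/

open Finset in
/-- Sets whose traces on `C` pairwise meet in at least `l ≥ 1` points either share `l` points of `C`,
or all meet a bounded subset of `C` in more than `l` points. -/
theorem exists_kernel_or_cover {α : Type*} [DecidableEq α] {k l : ℕ} (hl : 1 ≤ l)
    (C : Finset α) (𝒟 : Finset (Finset α)) (h𝒟 : 2 ≤ 𝒟.card) (hk : ∀ D ∈ 𝒟, D.card ≤ k)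
    (hint : ∀ D ∈ 𝒟, ∀ E ∈ 𝒟, D ≠ E → l ≤ (C ∩ D ∩ E).card) :
    (∃ T ⊆ C, T.card = l ∧ ∀ D ∈ 𝒟, T ⊆ D) ∨
      ∃ U ⊆ C, U.card + k ≤ k ^ 2 + 1 ∧ l + 1 ≤ U.card ∧ ∀ D ∈ 𝒟, l + 1 ≤ (D ∩ U).card := by
  have hother : ∀ D ∈ 𝒟, ∃ E ∈ 𝒟, D ≠ E := fun D _ => by
    obtain ⟨E, hE, h⟩ := exists_mem_ne (by omega : 1 < 𝒟.card) D
    exact ⟨E, hE, h.symm⟩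
  have hle : ∀ D ∈ 𝒟, l ≤ (C ∩ D).card := fun D hD => by
    obtain ⟨E, hE, h⟩ := hother D hD
    exact (hint D hD E hE h).trans (card_le_card inter_subset_left)
  by_cases hsmall : ∃ D ∈ 𝒟, (C ∩ D).card = l
  · obtain ⟨D, hD, hDl⟩ := hsmall
    refine Or.inl ⟨C ∩ D, inter_subset_left, hDl, fun E hE => ?_⟩
    by_cases h : D = E
    · exact h ▸ inter_subset_right
    · have := eq_of_subset_of_card_le (inter_subset_left : C ∩ D ∩ E ⊆ C ∩ D)
        (by rw [hDl]; exact hint D hD E hE h)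
      exact this ▸ inter_subset_right
  have hlt : ∀ D ∈ 𝒟, l + 1 ≤ (C ∩ D).card := fun D hD =>
    lt_of_le_of_ne (hle D hD) fun h => hsmall ⟨D, hD, h.symm⟩
  have hD0 : 𝒟.Nonempty := card_pos.1 (by omega)
  by_cases hpair : ∃ D ∈ 𝒟, ∃ E ∈ 𝒟, D ≠ E ∧ (C ∩ D ∩ E).card = l
  swap
  · obtain ⟨D, hD⟩ := hD0
    refine Or.inr ⟨C ∩ D, inter_subset_left, ?_, hlt D hD, fun E hE => ?_⟩
    · have : (C ∩ D).card ≤ k := (card_le_card inter_subset_right).trans (hk D hD)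
      have : k + k ≤ k ^ 2 + 1 := by zify; nlinarith [sq_nonneg ((k : ℤ) - 1)]
      omega
    · by_cases h : D = E
      · subst h
        rw [inter_eq_right.2 inter_subset_right]
        exact hlt D hD
      · rw [inter_comm]
        exact lt_of_le_of_ne (hint D hD E hE h) fun h' => hpair ⟨D, hD, E, hE, h, h'.symm⟩
  obtain ⟨D₀, hD₀, E₀, hE₀, hne₀, hcard₀⟩ := hpair
  set T := C ∩ D₀ ∩ E₀ with hT
  have hTC : T ⊆ C := inter_subset_left.trans inter_subset_left
  -- Sunflowers with core T among the traces on C; a largest one is used.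
  let 𝒮 := 𝒟.powerset.filter fun S => ∀ D ∈ S, ∀ E ∈ S, D ≠ E → C ∩ D ∩ E = T
  have hmem₀ : ({D₀, E₀} : Finset (Finset α)) ∈ 𝒮 := by
    simp only [𝒮, mem_filter, mem_powerset, insert_subset_iff, singleton_subset_iff]
    refine ⟨⟨hD₀, hE₀⟩, fun D hD E hE h => ?_⟩
    rw [mem_insert, mem_singleton] at hD hE
    rcases hD with rfl | rfl <;> rcases hE with rfl | rfl
    · exact absurd rfl h
    · rfl
    · rw [hT, inter_right_comm]
    · exact absurd rfl h
  obtain ⟨S, hS, hmax⟩ := exists_max_image 𝒮 card ⟨_, hmem₀⟩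
  have hS2 : 2 ≤ S.card := by simpa [card_pair hne₀] using hmax _ hmem₀
  simp only [𝒮, mem_filter, mem_powerset] at hS hmax
  obtain ⟨hS𝒟, hS⟩ := hS
  have hTS : ∀ D ∈ S, T ⊆ C ∩ D := fun D hD => by
    obtain ⟨E, hE, h⟩ := exists_mem_ne (by omega : 1 < S.card) D
    rw [← hS D hD E hE h.symm]
    exact inter_subset_left
  by_cases hSk : k < S.card
  · refine Or.inl ⟨T, hTC, hcard₀, fun D hD => ?_⟩
    -- A set D missing part of T must meet each of the more than k disjoint petals, so |D| > k.
    by_contra hTD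
    have hDS : D ∉ S := fun h => hTD ((hTS D h).trans inter_subset_right)
    have hex : ∀ E ∈ S, ∃ x, x ∈ C ∩ E ∩ D ∧ x ∉ T := fun E hE => by
      by_contra! hcon
      have hsub : C ∩ E ∩ D ⊆ T := hcon
      have heq := eq_of_subset_of_card_le hsub
        (by rw [hcard₀]; exact hint E (hS𝒟 hE) D hD fun h => hDS (h ▸ hE))
      exact hTD (heq ▸ inter_subset_right)
    obtain ⟨x₀, _⟩ : T.Nonempty := card_pos.1 (by omega)
    have : Nonempty α := ⟨x₀⟩
    choose! f hf hfT using hex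
    have hinj : S.card ≤ D.card := by
      refine card_le_card_of_injOn f (fun E hE => (mem_inter.1 (hf E hE)).2) fun E hE E' hE' h => ?_
      by_contra hne
      apply hfT E hE
      rw [← hS E hE E' hE' hne]
      refine mem_inter.2 ⟨(mem_inter.1 (hf E hE)).1, ?_⟩
      rw [h]
      exact (mem_inter.1 (mem_inter.1 (hf E' hE')).1).2
    have := hk D hD
    omega
  · have hUsub : ∀ E ∈ S, C ∩ E ⊆ S.biUnion fun E => C ∩ E := fun E hE =>
      subset_biUnion_of_mem (fun E => C ∩ E) hE
    obtain ⟨E₁, hE₁⟩ : S.Nonempty := card_pos.1 (by omega)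
    refine Or.inr ⟨S.biUnion fun E => C ∩ E, biUnion_subset.2 fun E _ => inter_subset_left, ?_,
      (hlt E₁ (hS𝒟 hE₁)).trans (card_le_card (hUsub E₁ hE₁)), fun D hD => ?_⟩
    · have hsub : (S.biUnion fun E => C ∩ E) ⊆ T ∪ S.biUnion fun E => (C ∩ E) \ T := by
        intro x hx
        obtain ⟨E, hE, hxE⟩ := mem_biUnion.1 hx
        by_cases hxT : x ∈ T
        · exact mem_union_left _ hxT
        · exact mem_union_right _ (mem_biUnion.2 ⟨E, hE, mem_sdiff.2 ⟨hxE, hxT⟩⟩)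
      have h1 : (S.biUnion fun E => (C ∩ E) \ T).card ≤ S.card * (k - l) := by
        refine card_biUnion_le_card_mul _ _ _ fun E hE => ?_
        rw [card_sdiff_of_subset (hTS E hE), hcard₀]
        exact Nat.sub_le_sub_right ((card_le_card inter_subset_right).trans (hk E (hS𝒟 hE))) l
      have h2 := (card_le_card hsub).trans (card_union_le _ _)
      have h3 : S.card * (k - l) ≤ k * (k - l) := Nat.mul_le_mul_right _ (by omega)
      have h4 : l ≤ k := (hle E₁ (hS𝒟 hE₁)).trans
        ((card_le_card inter_subset_right).trans (hk E₁ (hS𝒟 hE₁)))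
      obtain ⟨j, rfl⟩ := Nat.exists_eq_add_of_le h4
      obtain ⟨i, rfl⟩ := Nat.exists_eq_add_of_le hl
      rw [Nat.add_sub_cancel_left] at h3 h1
      nlinarith
    · by_cases hDS : D ∈ S
      · exact (hlt D hD).trans (card_le_card (subset_inter inter_subset_right (hUsub D hDS)))
      -- If |D ∩ U| ≤ l, then D ∩ U equals each C ∩ D ∩ E with E in S, hence equals T, and D would
      -- enlarge the sunflower.
      by_contra! hcon
      have hDT : ∀ E ∈ S, C ∩ D ∩ E = T := by
        have hall : ∀ E ∈ S, C ∩ D ∩ E = D ∩ S.biUnion fun E => C ∩ E := fun E hE => by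
          refine eq_of_subset_of_card_le (fun x hx => ?_)
            ((Nat.le_of_lt_succ hcon).trans (hint D hD E (hS𝒟 hE) fun h => hDS (h ▸ hE)))
          simp only [mem_inter] at hx
          exact mem_inter.2 ⟨hx.1.2, hUsub E hE (mem_inter.2 ⟨hx.1.1, hx.2⟩)⟩
        intro E hE
        obtain ⟨E', hE', h⟩ := exists_mem_ne (by omega : 1 < S.card) E
        refine eq_of_subset_of_card_le ?_
          (by rw [hcard₀]; exact hint D hD E (hS𝒟 hE) fun h => hDS (h ▸ hE))
        rw [← hS E hE E' hE' h.symm]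
        intro x hx
        have hx' : x ∈ C ∩ D ∩ E' := by rw [hall E' hE', ← hall E hE]; exact hx
        simp only [mem_inter] at hx hx' ⊢
        exact ⟨⟨hx.1.1, hx.2⟩, hx'.2⟩
      have := hmax (insert D S) ⟨insert_subset hD hS𝒟, fun E hE E' hE' h => by
        rcases mem_insert.1 hE with rfl | h₁ <;> rcases mem_insert.1 hE' with rfl | h₂
        · exact absurd rfl h
        · exact hDT E' h₂
        · rw [inter_right_comm]; exact hDT E h₁
        · exact hS E h₁ E' h₂ h⟩
      rw [card_insert_of_notMem hDS] at this
      omega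

-- Fix t - 2 members and let C be their intersection: any two others meet inside C in at least l
-- points, while the fixed ones contain all of C.
open Finset in
theorem exists_kernel_or_cover_of_twise {n t k l : ℕ} (ht : 2 ≤ t) (hl : 1 ≤ l)
    {A : Finset (Finset (Fin n))} (hAt : t ≤ A.card) (hk : ∀ F ∈ A, F.card ≤ k)
    (hint : ∀ B ⊆ A, B.card = t → l ≤ (B.inf id).card) :
    (∃ T : Finset (Fin n), T.card = l ∧ ∀ F ∈ A, T ⊆ F) ∨
      ∃ U : Finset (Fin n), U.card + k ≤ k ^ 2 + 1 ∧ ∀ F ∈ A, l + 1 ≤ (F ∩ U).card := by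
  obtain ⟨B, hBA, hB⟩ := exists_subset_card_eq (by omega : t - 2 ≤ A.card)
  have hsd := card_sdiff_add_card_eq_card hBA
  have hC : ∀ F ∈ B, B.inf id ⊆ F := fun F hF => inf_le (f := id) hF
  rcases exists_kernel_or_cover hl (B.inf id) (A \ B) (by omega)
    (fun D hD => hk D (sdiff_subset hD)) (fun D hD E hE hne => by
      obtain ⟨hDA, hDB⟩ := mem_sdiff.1 hD
      obtain ⟨hEA, hEB⟩ := mem_sdiff.1 hE
      have := hint (insert E (insert D B)) (insert_subset hEA (insert_subset hDA hBA)) (by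
        rw [card_insert_of_notMem, card_insert_of_notMem hDB]
        · omega
        · rw [mem_insert]; exact fun h => h.elim (fun h => hne h.symm) hEB)
      have heq : (insert E (insert D B)).inf id = B.inf id ∩ D ∩ E := by
        simp only [inf_insert, id, inf_eq_inter]
        rw [inter_comm E, inter_comm D]
      rwa [heq] at this) with ⟨T, hTC, hT, h⟩ | ⟨U, hUC, hU, hlU, h⟩
  · refine Or.inl ⟨T, hT, fun F hF => ?_⟩
    by_cases hFB : F ∈ B
    · exact hTC.trans (hC F hFB)
    · exact h F (mem_sdiff.2 ⟨hF, hFB⟩)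
  · refine Or.inr ⟨U, hU, fun F hF => ?_⟩
    by_cases hFB : F ∈ B
    · rwa [inter_eq_right.2 (hUC.trans (hC F hFB))]
    · exact h F (mem_sdiff.2 ⟨hF, hFB⟩)

/-! ### Bounds from a cover or a kernel -/

open Finset in
/-- If `l ∈ L` is not the size of any `t`-wise intersection, the bound improves by one degree. -/
theorem IsTWiseIntersecting.card_le_of_avoid {n t l : ℕ} (ht : 2 ≤ t) {L : Finset ℕ} (hl : l ∈ L)
    {A : Finset (Finset (Fin n))} (hA : IsTWiseIntersecting t L A)
    (hAL : ∀ F ∈ A, F.card ∉ L) (h : ∀ B ⊆ A, B.card = t → (B.inf id).card ≠ l) :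
    A.card ≤ (t - 1) * ∑ i ∈ range L.card, n.choose i := by
  have h' : IsTWiseIntersecting t (L.erase l) A := fun B hB hBt =>
    mem_erase.2 ⟨h B hB hBt, hA B hB hBt⟩
  have := h'.card_le ht fun F hF hFL => hAL F hF (mem_of_mem_erase hFL)
  rwa [card_erase_add_one hl] at this

open Finset in
theorem IsTWiseIntersecting.card_le_of_cover {n t l : ℕ} (ht : 2 ≤ t) {L : Finset ℕ} (hl : l ∈ L)
    {A : Finset (Finset (Fin n))} (hA : IsTWiseIntersecting t L A) (hAL : ∀ F ∈ A, F.card ∉ L)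
    {U : Finset (Fin n)} (hU : ∀ F ∈ A, l + 1 ≤ (F ∩ U).card) :
    A.card ≤ U.card.choose (l + 1) * ((t - 1) * ∑ i ∈ range L.card, n.choose i) := by
  have hsub : A ⊆ (powersetCard (l + 1) U).biUnion fun M => A.filter (M ⊆ ·) := fun F hF => by
    obtain ⟨M, hM, hMc⟩ := exists_subset_card_eq (hU F hF)
    exact mem_biUnion.2 ⟨M, mem_powersetCard.2 ⟨hM.trans inter_subset_right, hMc⟩,
      mem_filter.2 ⟨hF, hM.trans inter_subset_left⟩⟩
  rw [← card_powersetCard]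
  refine (card_le_card hsub).trans (card_biUnion_le_card_mul _ _ _ fun M hM => ?_)
  refine (hA.mono (filter_subset _ _)).card_le_of_avoid ht hl
    (fun F hF => hAL F (filter_subset _ _ hF)) fun B hB _ => ?_
  have : M ⊆ B.inf id := Finset.le_inf fun F hF => (mem_filter.1 (hB hF)).2
  have := card_le_card this
  rw [(mem_powersetCard.1 hM).2] at this
  omega

open Finset in
/-- The case of consecutive intersection sizes. -/
theorem IsTWiseIntersecting.card_le_of_kernel_of_lt {n t l : ℕ} (ht : 2 ≤ t) {L : Finset ℕ}
    (hl : IsLeast (L : Set ℕ) l) {A : Finset (Finset (Fin n))} (hA : IsTWiseIntersecting t L A)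
    (hAL : ∀ F ∈ A, F.card ∉ L) {T : Finset (Fin n)} (hT : T.card = l) (hTA : ∀ F ∈ A, T ⊆ F)
    (hL : ∀ j ∈ L, j < l + L.card) :
    A.card ≤ (t - 1) * n.choose L.card := by
  have hLI : L = Ico l (l + L.card) :=
    eq_of_subset_of_card_le (fun j hj => mem_Ico.2 ⟨hl.2 hj, hL j hj⟩) (by simp)
  have hsub : A ⊆ (powersetCard L.card univ).biUnion fun R => A.filter (R ⊆ · \ T) := fun F hF => by
    have h1 : l ≤ F.card := hT ▸ card_le_card (hTA F hF)
    have h2 : l + L.card ≤ F.card := by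
      by_contra! h
      exact hAL F hF (hLI ▸ mem_Ico.2 ⟨h1, h⟩)
    have h3 : L.card ≤ (F \ T).card := by rw [card_sdiff_of_subset (hTA F hF)]; omega
    obtain ⟨R, hR, hRc⟩ := exists_subset_card_eq h3
    exact mem_biUnion.2 ⟨R, mem_powersetCard.2 ⟨subset_univ _, hRc⟩, mem_filter.2 ⟨hF, hR⟩⟩
  rw [mul_comm]
  have hc : (powersetCard L.card (univ : Finset (Fin n))).card = n.choose L.card := by simp
  rw [← hc]
  refine (card_le_card hsub).trans (card_biUnion_le_card_mul _ _ _ fun R hR => ?_)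
  -- Any t members containing T ∪ R would meet in at least l + s points, too many for L.
  by_contra! h
  obtain ⟨B, hB, hBt⟩ := exists_subset_card_eq (by omega : t ≤ (A.filter (R ⊆ · \ T)).card)
  obtain ⟨F, hF⟩ : B.Nonempty := card_pos.1 (by omega)
  have hdisj : Disjoint T R :=
    (disjoint_of_subset_left (mem_filter.1 (hB hF)).2 sdiff_disjoint).symm
  have hinf : T ∪ R ⊆ B.inf id := Finset.le_inf fun F hF => by
    have := mem_filter.1 (hB hF)
    exact union_subset (hTA F this.1) (this.2.trans sdiff_subset)
  have h1 := card_le_card hinf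
  rw [card_union_of_disjoint hdisj, hT, (mem_powersetCard.1 hR).2] at h1
  have := hL _ (hA B (hB.trans (filter_subset _ _)) hBt)
  omega

theorem mul_sum_choose_le_succ_mul_choose {n s : ℕ} (hs : 2 ≤ s) (hn : (s + 1) ^ 2 * s ≤ n) :
    (n + s + 1) * ∑ i ∈ Finset.range s, n.choose i ≤ (s + 1) * n.choose s := by
  obtain ⟨p, rfl⟩ := Nat.exists_eq_add_of_le' hs
  obtain ⟨q, rfl⟩ := Nat.exists_eq_add_of_le hn
  set n := (p + 2 + 1) ^ 2 * (p + 2) + q with hndef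
  rw [show p + 2 = (p + 1) + 1 from rfl, Finset.sum_range_succ]
  -- With s = p + 2, the multiplier is (s+1)² - 2.
  have h1 := mul_sum_choose_le_choose (p ^ 2 + 6 * p + 7) n (p + 1) (by rw [hndef]; nlinarith)
  have h2 := Nat.choose_succ_right_eq n (p + 1)
  generalize ∑ i ∈ Finset.range (p + 1), n.choose i = w at *
  generalize n.choose (p + 1) = g at *
  generalize n.choose (p + 1 + 1) = c at *
  obtain ⟨r, hr⟩ : ∃ r, n = p + 1 + r := Nat.exists_eq_add_of_le (by rw [hndef]; nlinarith)
  have hrq : r = p ^ 3 + 8 * p ^ 2 + 20 * p + 17 + q := by rw [hndef] at hr; nlinarith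
  rw [show n - (p + 1) = r by omega] at h2
  have h3 : (p + 2) * (n + (p + 1 + 1) + 1) * (p ^ 2 + 6 * p + 8) ≤
      (p ^ 2 + 6 * p + 7) * (p + 3) * r := by
    rw [hr, hrq]; ring_nf; nlinarith
  refine Nat.le_of_mul_le_mul_left (c := (p + 2) * (p ^ 2 + 6 * p + 7)) ?_ (by positivity)
  calc (p + 2) * (p ^ 2 + 6 * p + 7) * ((n + (p + 1 + 1) + 1) * (w + g))
      = (p + 2) * (n + (p + 1 + 1) + 1) * ((p ^ 2 + 6 * p + 7) * w + (p ^ 2 + 6 * p + 7) * g) := by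
        ring
    _ ≤ (p + 2) * (n + (p + 1 + 1) + 1) * (g + (p ^ 2 + 6 * p + 7) * g) := by gcongr
    _ = (p + 2) * (n + (p + 1 + 1) + 1) * (p ^ 2 + 6 * p + 8) * g := by ring
    _ ≤ (p ^ 2 + 6 * p + 7) * (p + 3) * r * g := by gcongr
    _ = (p ^ 2 + 6 * p + 7) * (p + 3) * (g * r) := by ring
    _ = (p + 2) * (p ^ 2 + 6 * p + 7) * ((p + 1 + 1 + 1) * c) := by rw [← h2]; ring

open Finset in
theorem IsTWiseIntersecting.card_le_of_kernel_of_le {n t l m : ℕ} (ht : 2 ≤ t) {L : Finset ℕ}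
    (hl : l ∈ L) (hm : IsGreatest (L : Set ℕ) m) {A : Finset (Finset (Fin n))}
    (hA : IsTWiseIntersecting t L A) (hAL : ∀ F ∈ A, F.card ∉ L) {T : Finset (Fin n)}
    (hT : T.card = l) (hTA : ∀ F ∈ A, T ⊆ F) (hL : l + L.card ≤ m)
    (hn : (L.card + 1) ^ 2 * L.card ≤ n) :
    A.card ≤ (t - 1) * n.choose L.card := by
  have hpos : 0 < L.card := card_pos.2 ⟨l, hl⟩
  have hs : 2 ≤ L.card := one_lt_card.2 ⟨l, hl, m, hm.1, by omega⟩
  have hsmall : (A.filter fun F => ¬ m < F.card).card ≤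
      (t - 1) * ∑ i ∈ range L.card, n.choose i := by
    refine (hA.mono (filter_subset _ _)).card_le_of_avoid ht hm.1
      (fun F hF => hAL F (filter_subset _ _ hF)) fun B hB hBt h => ?_
    obtain ⟨F, hF⟩ : B.Nonempty := card_pos.1 (by omega)
    obtain ⟨hFA, hFm⟩ := mem_filter.1 (hB hF)
    have h1 : (B.inf id).card ≤ F.card := card_le_card (inf_le (f := id) hF)
    exact hAL F hFA (by rw [show F.card = m by omega]; exact hm.1)
  have hlarge : (A.filter fun F => m < F.card).card * (L.card + 1) ≤
      n * ((t - 1) * ∑ i ∈ range L.card, n.choose i) := by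
    have := card_mul_le_card_mul (s := A.filter fun F => m < F.card) (t := (univ : Finset (Fin n)))
      (fun F x => x ∈ F \ T) (m := L.card + 1) (n := (t - 1) * ∑ i ∈ range L.card, n.choose i)
      (fun F hF => ?_) (fun x _ => ?_)
    · simpa using this
    · obtain ⟨hFA, hFm⟩ := mem_filter.1 hF
      have h1 : (univ : Finset (Fin n)).bipartiteAbove (fun F x => x ∈ F \ T) F = F \ T := by
        ext x; simp [mem_bipartiteAbove]
      rw [h1, card_sdiff_of_subset (hTA F hFA)]
      omega
    · have hsub : ((A.filter fun F => m < F.card).bipartiteBelow (fun F x => x ∈ F \ T) x) ⊆ A :=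
        (filter_subset _ _).trans (filter_subset _ _)
      refine (hA.mono hsub).card_le_of_avoid ht hl (fun F hF => hAL F (hsub hF)) fun B hB hBt => ?_
      have hx : ∀ F ∈ B, x ∈ F \ T := fun F hF => (mem_bipartiteBelow _).1 (hB hF) |>.2
      obtain ⟨F, hF⟩ : B.Nonempty := card_pos.1 (by omega)
      have hinf : insert x T ⊆ B.inf id := Finset.le_inf fun F hF =>
        insert_subset (mem_sdiff.1 (hx F hF)).1 (hTA F (hsub (hB hF)))
      have := card_le_card hinf
      rw [card_insert_of_notMem (mem_sdiff.1 (hx F hF)).2, hT] at this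
      omega
  have hsplit := card_filter_add_card_filter_not (s := A) fun F => m < F.card
  have hnum := Nat.mul_le_mul_left (t - 1) (mul_sum_choose_le_succ_mul_choose hs hn)
  refine Nat.le_of_mul_le_mul_left (c := L.card + 1) ?_ (by positivity)
  rw [← hsplit]
  nlinarith

/-- For s ≥ 2, C(u,l+1) ≤ (u/k²) C(k²,l+1), and the slack u ≤ k² - k + 1 pays for the terms below
C(n,s-1), since (k²+1)(k²-k+1) < k⁴ for k ≥ 3. -/
theorem choose_mul_sum_choose_le_choose {n s k l u : ℕ} (hl : 1 ≤ l) (hs : 1 ≤ s) (hk : s + l ≤ k)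
    (hu : u + k ≤ k ^ 2 + 1) (hn : (k ^ 2).choose (l + 1) * s + l ≤ n) :
    u.choose (l + 1) * ∑ i ∈ Finset.range s, n.choose i ≤ n.choose s := by
  have huk : u ≤ k ^ 2 := by omega
  rcases hs.eq_or_lt with rfl | hs2
  · have := Nat.choose_le_choose (l + 1) huk
    simp
    omega
  have hk3 : 3 ≤ k := by omega
  set c := (k ^ 2).choose (l + 1) with hc
  have hck : k ^ 2 ≤ c := Nat.le_choose_of_pos_of_lt (by omega) (by nlinarith)
  have hdc : k ^ 2 * u.choose (l + 1) ≤ u * c := by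
    rcases Nat.eq_zero_or_pos u with rfl | hu0
    · simp
    obtain ⟨v, rfl⟩ : ∃ v, u = v + 1 := ⟨u - 1, by omega⟩
    obtain ⟨K, hK⟩ : ∃ K, k ^ 2 = K + 1 := Nat.exists_eq_add_one.2 (by positivity)
    rw [hc, hK]
    have h1 := Nat.add_one_mul_choose_eq v l
    have h2 := Nat.add_one_mul_choose_eq K l
    have h3 := Nat.choose_le_choose l (show v ≤ K by omega)
    refine Nat.le_of_mul_le_mul_right (c := l + 1) ?_ (by omega)
    calc (K + 1) * (v + 1).choose (l + 1) * (l + 1) = (K + 1) * ((v + 1) * v.choose l) := by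
          rw [h1]; ring
      _ ≤ (K + 1) * ((v + 1) * K.choose l) := by gcongr
      _ = (v + 1) * (K + 1).choose (l + 1) * (l + 1) := by rw [mul_assoc, ← h2]; ring
  obtain ⟨p, rfl⟩ : ∃ p, s = p + 1 := ⟨s - 1, by omega⟩
  rw [Finset.sum_range_succ]
  have hcs : k ^ 2 * (p + 1) ≤ c * (p + 1) := Nat.mul_le_mul_right _ hck
  have hW := mul_sum_choose_le_choose (k ^ 2) n p (by nlinarith)
  have hch := Nat.choose_succ_right_eq n p
  obtain ⟨r, hr⟩ : ∃ r, n = p + r := Nat.exists_eq_add_of_le (by nlinarith)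
  rw [show n - p = r by omega] at hch
  generalize ∑ i ∈ Finset.range p, n.choose i = w at *
  generalize n.choose p = g at *
  generalize n.choose (p + 1) = C at *
  generalize u.choose (l + 1) = d at *
  have hkey : (k ^ 2 + 1) * u * c * (p + 1) ≤ k ^ 4 * r := by
    obtain ⟨j, rfl⟩ := Nat.exists_eq_add_of_le' hk3
    have hu' : u ≤ j ^ 2 + 5 * j + 7 := by nlinarith
    have hr' : c * (p + 1) ≤ r + p := by omega
    have h5 : (j + 3) ^ 4 * (p + 1) ≤ (j ^ 3 + 7 * j ^ 2 + 16 * j + 11) * (c * (p + 1)) := by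
      calc (j + 3) ^ 4 * (p + 1) = (j + 3) ^ 2 * ((j + 3) ^ 2 * (p + 1)) := by ring
        _ ≤ (j ^ 3 + 7 * j ^ 2 + 16 * j + 11) * (c * (p + 1)) :=
          Nat.mul_le_mul (by nlinarith [Nat.zero_le (j ^ 3)]) hcs
    have h6 : ((j + 3) ^ 2 + 1) * u * c * (p + 1) ≤
        ((j + 3) ^ 2 + 1) * (j ^ 2 + 5 * j + 7) * (c * (p + 1)) := by
      rw [mul_assoc _ c]; gcongr
    have h7 : (j + 3) ^ 4 * (c * (p + 1)) ≤ (j + 3) ^ 4 * (r + p) := Nat.mul_le_mul_left _ hr'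
    have h8 : ((j + 3) ^ 2 + 1) * (j ^ 2 + 5 * j + 7) + (j ^ 3 + 7 * j ^ 2 + 16 * j + 11) =
      (j + 3) ^ 4 := by ring
    have h9 : (j + 3) ^ 4 * (c * (p + 1)) = ((j + 3) ^ 2 + 1) * (j ^ 2 + 5 * j + 7) * (c * (p + 1))
        + (j ^ 3 + 7 * j ^ 2 + 16 * j + 11) * (c * (p + 1)) := by rw [← h8]; ring
    rw [mul_add] at h7
    rw [mul_add, mul_one] at h5
    linarith [Nat.zero_le ((j + 3) ^ 4)]
  refine Nat.le_of_mul_le_mul_left (c := k ^ 4 * (p + 1)) ?_ (by positivity)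
  calc k ^ 4 * (p + 1) * (d * (w + g)) = (k ^ 2 * d) * (p + 1) * (k ^ 2 * w + k ^ 2 * g) := by ring
    _ ≤ (u * c) * (p + 1) * (g + k ^ 2 * g) := by gcongr
    _ = (k ^ 2 + 1) * u * c * (p + 1) * g := by ring
    _ ≤ k ^ 4 * r * g := by gcongr
    _ = k ^ 4 * (p + 1) * C := by rw [mul_assoc, mul_comm r, ← hch]; ring

theorem Nat.choose_le_choose_right_of_le_half {n s s' : ℕ} (h : s' ≤ s) (hs : s ≤ n / 2) :
    n.choose s' ≤ n.choose s := by
  induction s, h using Nat.le_induction with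
  | base => exact le_rfl
  | succ s _ ih => exact (ih (by omega)).trans (Nat.choose_le_succ_of_lt_half_left (by omega))

/-! ### Assembling the cases -/

open Finset in
/-- The bound when all intersection sizes are smaller than the largest allowed member size. -/
theorem IsTWiseIntersecting.card_le_of_lt {n t k l : ℕ} (ht : 2 ≤ t) {L : Finset ℕ}
    (hl : IsLeast (L : Set ℕ) l) (hLk : ∀ j ∈ L, j < k) {A : Finset (Finset (Fin n))}
    (hAt : t ≤ A.card) (hA : IsTWiseIntersecting t L A) (hAL : ∀ F ∈ A, F.card ∉ L)
    (hk2 : 2 ≤ k) (hk : ∀ F ∈ A, F.card ≤ k)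
    (hn : (k ^ 2).choose (l + 1) * L.card + l ≤ n) :
    A.card ≤ (t - 1) * n.choose L.card := by
  have hlL : l ∈ L := hl.1
  have hlk := hLk l hlL
  have hs : 1 ≤ L.card := card_pos.2 ⟨l, hlL⟩
  have hck : k ^ 2 ≤ (k ^ 2).choose (l + 1) :=
    Nat.le_choose_of_pos_of_lt (Nat.succ_pos l) (by nlinarith)
  have hkernel : (∃ T : Finset (Fin n), T.card = l ∧ ∀ F ∈ A, T ⊆ F) →
      A.card ≤ (t - 1) * n.choose L.card := by
    rintro ⟨T, hT, hTA⟩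
    by_cases hL : ∀ j ∈ L, j < l + L.card
    · exact hA.card_le_of_kernel_of_lt ht hl hAL hT hTA hL
    push Not at hL
    obtain ⟨j, hj, hjl⟩ := hL
    have hm := isGreatest_max' L ⟨l, hlL⟩
    have hjm := hm.2 hj
    have := hLk j hj
    refine hA.card_le_of_kernel_of_le ht hlL hm hAL hT hTA (hjl.trans hjm) ?_
    calc (L.card + 1) ^ 2 * L.card ≤ k ^ 2 * L.card :=
          Nat.mul_le_mul_right _ (Nat.pow_le_pow_left (by omega) 2)
      _ ≤ (k ^ 2).choose (l + 1) * L.card := Nat.mul_le_mul_right _ hck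
      _ ≤ n := by omega
  rcases Nat.eq_zero_or_pos l with rfl | hlpos
  · exact hkernel ⟨∅, rfl, fun F _ => empty_subset F⟩
  rcases exists_kernel_or_cover_of_twise ht hlpos hAt hk fun B hB hBt => hl.2 (hA B hB hBt) with
    h | ⟨U, hU, hUA⟩
  · exact hkernel h
  have hLc : L.card + l ≤ k := by
    have := card_le_card (fun j hj => mem_Ico.2 ⟨hl.2 hj, hLk j hj⟩ : L ⊆ Ico l k)
    rw [Nat.card_Ico] at this
    omega
  refine (hA.card_le_of_cover ht hlL hAL hUA).trans ?_
  rw [mul_left_comm]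
  exact Nat.mul_le_mul_left _ (choose_mul_sum_choose_le_choose hlpos hs hLc hU hn)

open Finset in
/-- The intersection of at least two distinct sets is smaller than the largest of them. -/
theorem card_inf_lt_of_two_le_card {n k : ℕ} {B : Finset (Finset (Fin n))} (hB : 2 ≤ B.card)
    (hk : ∀ F ∈ B, F.card ≤ k) : (B.inf id).card < k := by
  obtain ⟨F, hF, F', hF', hne⟩ := one_lt_card.1 hB
  by_contra! h
  have h1 : B.inf id = F := eq_of_subset_of_card_le (inf_le (f := id) hF) ((hk F hF).trans h)
  have h2 : B.inf id = F' := eq_of_subset_of_card_le (inf_le (f := id) hF') ((hk F' hF').trans h)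
  exact hne (h1.symm.trans h2)

open Finset in
theorem theorem1p10 (n t s l₁ : ℕ) (ht : 2 ≤ t) (L : Finset ℕ) (hs : L.card = s)
    (hl₁ : IsLeast (L : Set ℕ) l₁) (hsn : s < n)
    (A : Finset (Finset (Fin n)))
    (hA : IsTWiseIntersecting t L A)
    (hAL : ∀ F ∈ A, F.card ∉ L)
    (hn : ((maxMemberSize A) ^ 2).choose (l₁ + 1) * s + l₁ ≤ n) :
    A.card ≤ (t - 1) * n.choose s := by
  have hchoose : 0 < n.choose s := Nat.choose_pos hsn.le
  rcases Nat.lt_or_ge A.card t with hAt | hAt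
  · exact (show A.card ≤ t - 1 by omega).trans (Nat.le_mul_of_pos_right _ hchoose)
  have hk : ∀ F ∈ A, F.card ≤ maxMemberSize A := fun F hF => le_sup (f := card) hF
  generalize maxMemberSize A = k at hk hn
  have hinf : ∀ B ⊆ A, B.card = t → (B.inf id).card < k := fun B hB hBt =>
    card_inf_lt_of_two_le_card (by omega) fun F hF => hk F (hB hF)
  obtain ⟨B, hB, hBt⟩ := exists_subset_card_eq hAt
  have hBk := hinf B hB hBt
  have hlk : l₁ < k := (hl₁.2 (hA B hB hBt)).trans_lt hBk
  have hspos : 0 < s := hs ▸ card_pos.2 ⟨l₁, hl₁.1⟩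
  -- For k = 1 the inequality k² ≤ C(k², l+1) is not available from l + 1 < k², but all members are
  -- singletons.
  rcases Nat.lt_or_ge k 2 with hk1 | hk2
  · have h0 : 0 ∈ L := by
      have := hl₁.1
      rwa [show l₁ = 0 by omega] at this
    have hsub : A ⊆ powersetCard 1 univ := fun F hF => mem_powersetCard.2 ⟨subset_univ _, by
      have := hk F hF
      have : F.card ≠ 0 := fun h => hAL F hF (h ▸ h0)
      omega⟩
    have := card_le_card hsub
    rw [card_powersetCard, card_univ, Fintype.card_fin, Nat.choose_one_right] at this
    calc A.card ≤ n.choose s := this.trans (Nat.le_choose_of_pos_of_lt hspos hsn)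
      _ ≤ (t - 1) * n.choose s := Nat.le_mul_of_pos_left _ (by omega)
  · have hck : k ^ 2 ≤ (k ^ 2).choose (l₁ + 1) :=
      Nat.le_choose_of_pos_of_lt (Nat.succ_pos _) (by nlinarith)
    -- Sizes at least k never occur as intersections, so they are dropped from L. This can only
    -- shrink s, and C(n,·) increases up to s because 4s ≤ n.
    have hLs : (L.filter (· < k)).card ≤ s := hs ▸ card_filter_le _ _
    have h := IsTWiseIntersecting.card_le_of_lt (L := L.filter (· < k)) (k := k) (l := l₁) ht
      ⟨mem_filter.2 ⟨hl₁.1, hlk⟩, fun j hj => hl₁.2 (mem_filter.1 hj).1⟩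
      (fun j hj => (mem_filter.1 hj).2) hAt
      (fun B hB hBt => mem_filter.2 ⟨hA B hB hBt, hinf B hB hBt⟩)
      (fun F hF h => hAL F hF (mem_filter.1 h).1) hk2 hk
      (le_trans (Nat.add_le_add_right (Nat.mul_le_mul_left _ hLs) _) hn)
    refine h.trans (Nat.mul_le_mul_left _ (Nat.choose_le_choose_right_of_le_half hLs ?_))
    have : 4 * s ≤ (k ^ 2).choose (l₁ + 1) * s := Nat.mul_le_mul_right _ (by nlinarith)
    omega
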